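/- **Definitions.** Let $V$ be a real vector space with an inner product $(\,,\,)$ (symmetric, positive definite) and a commutative bilinear, not necessarily associative, product $\cdot$. For $a\in V$ and $\mu\in\mathbb{R}$ put $V_\mu^{(a)}=\{v\in V : a\cdot v=\mu v\}$. Consider: - (M1) $(u,v\cdot w)=(u\cdot v,w)$ for all $u,v,w\in V$; - (M2) $(u\cdot u,v\cdot v)\ge (u\cdot v,u\cdot v)$ for all $u,v\in V$. A vector $a\in V\setminus\{0\}$ is a *Majorana axis* if: - (M3) $(a,a)=1$ and $a\cdot a=a$; - (M4) $V=V_1^{(a)}\oplus V_0^{(a)}\oplus V_{1/2^2}^{(a)}\oplus V_{1/2^5}^{(a)}$; - (M5) $V_1^{(a)}=\mathbb{R}a$; - (M6) the linear map $\tau(a)$ of $V$ that is the identity on $V_1^{(a)}\oplus V_0^{(a)}\oplus V_{1/2^2}^{(a)}$ and $-1$ on $V_{1/2^5}^{(a)}$ preserves the product; - (M7) with $V_+^{(a)}=V_1^{(a)}\oplus V_0^{(a)}\oplus V_{1/2^2}^{(a)}$, the linear map $\sigma(a)$ of $V_+^{(a)}$ that is the identity on $V_1^{(a)}\oplus V_0^{(a)}$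 and $-1$ on $V_{1/2^2}^{(a)}$ preserves the product of $V_+^{(a)}$. Two Majorana axes $a_0,a_1$ generate a dihedral algebra *of type $2A$* with third axis $a_\rho$ if the subalgebra generated by $a_0,a_1$ has basis $a_0,a_1,a_\rho$, these three vectors are idempotents of length $1$ with pairwise inner products $\frac1{2^3}$, and $x\cdot y=\frac1{2^3}(x+y-z)$ whenever $\{x,y,z\}=\{a_0,a_1,a_\rho\}$. A *Majorana representation* $(G,T,V)$ consists of a finite group $G$; a set $T$ of involutions that is stable under conjugation and generates $G$; a space $V$ as above satisfying (M1) and (M2) and generated as an algebra by a set $A$ of Majorana axes; a linear representation $\varphi:G\to GL(V)$ preserving both products; and a bijection $\psi:T\to A$ such that $\psi(t^g)=\psi(t)^{\varphi(g)}$ and $\varphi(t)=\tau(\psi(t))$ for all $t\in T$, $g\in G$; moreover it satisfies - (M8) if $t_0,t_1\in T$ and $\psi(t_0),\psi(t_1)$ generate a dihedral algebra of type $2A$ with third axis $a_\rho$, then $t_0t_1\in T$ and $\psi(t_0t_1)=a_\rho$; and if $t_0,t_1,t_2\in T$ with $t_0t_1t_2=1$, then $\psi(t_0),\psi(t_1)$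 generate a dihedral algebra of type $2A$ with third axis $\psi(t_2)$. **Lemma.** Let $K=\langle (1,2),\,(1,3)(2,4),\,(5,6)\rangle$, a group of permutations of $\{1,\dots,6\}$. Then $K\cong 2\times D_8$, where $D_8$ is the dihedral group of order $8$, and $K$ contains exactly eleven involutions, namely the pairwise distinct elements $$t_1=(1,2),\quad t_2=(3,4),\quad t_3=(1,2)(5,6),\quad t_4=(3,4)(5,6),$$ $$t_5=(1,3)(2,4)(5,6),\quad t_6=(1,4)(2,3)(5,6),\quad t_7=(1,3)(2,4),\quad t_8=(1,4)(2,3),$$ $$t_9=(1,2)(3,4),\quad t_{10}=(1,2)(3,4)(5,6),\quad t_{11}=(5,6).$$ Let $S=\{t_1,\dots,t_{10}\}$. Then there is no Majorana representation of the form $(K,S,U)$. -/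

import Mathlib

namespace Majorana

universe u v

/- Throughout, a real commutative (not necessarily associative) algebra `V` is a
`NonUnitalNonAssocCommRing` that is an `ℝ`-module with bilinear product. -/

section Algebra

variable {V : Type v} [NonUnitalNonAssocCommRing V] [Module ℝ V]
  [IsScalarTower ℝ V V] [SMulCommClass ℝ V V]

/-- The bilinear form `B` is an inner product on the real vector space `V`. -/
structure IsInnerProduct (B : LinearMap.BilinForm ℝ V) : Prop where
  symm : ∀ u v : V, B u v = B v u
  pos : ∀ v : V, v ≠ 0 → 0 < B v v

/-- `V_μ^{(a)} = {v | a · v = μ v}`, the `μ`-eigenspace of the adjoint action of `a`. -/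
noncomputable def eigSpace (a : V) (μ : ℝ) : Submodule ℝ V :=
  Module.End.eigenspace (LinearMap.mulLeft ℝ a) μ

/-- The four eigenvalues `1, 0, 1/2^2, 1/2^5`. -/
noncomputable def eigVal : Fin 4 → ℝ := ![1, 0, 1 / 2 ^ 2, 1 / 2 ^ 5]

/-- `τ` is the linear transformation `τ(a)`, acting as `(-1)^{2^5 μ}` on `V_μ^{(a)}` for
`μ = 1, 0, 1/2^2, 1/2^5`. When `V` is the sum of these four eigenspaces, exactly one `τ`
has this property. -/
structure IsTau (a : V) (τ : V →ₗ[ℝ] V) : Prop where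
  one : ∀ u ∈ eigSpace a 1, τ u = u
  zero : ∀ u ∈ eigSpace a 0, τ u = u
  quarter : ∀ u ∈ eigSpace a (1 / 2 ^ 2), τ u = u
  inv32 : ∀ u ∈ eigSpace a (1 / 2 ^ 5), τ u = -u

/-- `V_+^{(a)} = V_1^{(a)} ⊕ V_0^{(a)} ⊕ V_{1/2^2}^{(a)}`. -/
noncomputable def plusPart (a : V) : Submodule ℝ V :=
  eigSpace a 1 ⊔ eigSpace a 0 ⊔ eigSpace a (1 / 2 ^ 2)

/-- `σ` is the linear transformation `σ(a)` of `V_+^{(a)}`, acting as `(-1)^{2^2 μ}` on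
`V_μ^{(a)}` for `μ = 1, 0, 1/2^2`. As these eigenspaces span `V_+^{(a)}`, exactly one `σ` has
this property. -/
structure IsSigma (a : V) (σ : plusPart a →ₗ[ℝ] plusPart a) : Prop where
  one : ∀ u : plusPart a, (u : V) ∈ eigSpace a 1 → σ u = u
  zero : ∀ u : plusPart a, (u : V) ∈ eigSpace a 0 → σ u = u
  quarter : ∀ u : plusPart a, (u : V) ∈ eigSpace a (1 / 2 ^ 2) → σ u = -u

/-- `a` is a Majorana axis of the algebra `V` with inner product `B`: the axioms (M3)-(M7). -/
structure IsMajoranaAxis (B : LinearMap.BilinForm ℝ V) (a : V) : Prop where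
  ne_zero : a ≠ 0
  m3_length : B a a = 1
  m3_idem : a * a = a
  m4 : DirectSum.IsInternal fun i : Fin 4 => eigSpace a (eigVal i)
  m5 : eigSpace a 1 = Submodule.span ℝ {a}
  m6 : ∃ τ : V →ₗ[ℝ] V, IsTau a τ ∧ ∀ u v : V, τ u * τ v = τ (u * v)
  m7 : ∃ σ : plusPart a →ₗ[ℝ] plusPart a, IsSigma a σ ∧
    ∀ u v : plusPart a, ∃ h : (u : V) * (v : V) ∈ plusPart a,
      (σ u : V) * (σ v : V) = (σ ⟨(u : V) * (v : V), h⟩ : V)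

/-- `⟨⟨a₀, a₁⟩⟩` is a dihedral algebra of type `2A` with third basis vector `a_ρ = r`. -/
structure IsType2A (B : LinearMap.BilinForm ℝ V) (a₀ a₁ r : V) : Prop where
  linInd : LinearIndependent ℝ ![a₀, a₁, r]
  span_eq : Submodule.span ℝ {a₀, a₁, r} =
    (NonUnitalAlgebra.adjoin ℝ ({a₀, a₁} : Set V)).toSubmodule
  idem₀ : a₀ * a₀ = a₀
  idem₁ : a₁ * a₁ = a₁
  idem_r : r * r = r
  mul₀₁ : a₀ * a₁ = (1 / 2 ^ 3 : ℝ) • (a₀ + a₁ - r)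
  mul₀r : a₀ * r = (1 / 2 ^ 3 : ℝ) • (a₀ + r - a₁)
  mul₁r : a₁ * r = (1 / 2 ^ 3 : ℝ) • (a₁ + r - a₀)
  len₀ : B a₀ a₀ = 1
  len₁ : B a₁ a₁ = 1
  len_r : B r r = 1
  form₀₁ : B a₀ a₁ = 1 / 2 ^ 3
  form₀r : B a₀ r = 1 / 2 ^ 3
  form₁r : B a₁ r = 1 / 2 ^ 3

end Algebra

/-- A Majorana representation `(G, T, V, ·, B, φ, ψ)`. The group acts on `V` from the left; a
right action is turned into a left one by inverting the group element. The set `A` of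
Majorana axes is the range of `ψ`. -/
structure MajoranaRepresentation (G : Type u) [Group G] [Finite G] (T : Set G)
    (V : Type v) [NonUnitalNonAssocCommRing V] [Module ℝ V]
    [IsScalarTower ℝ V V] [SMulCommClass ℝ V V] where
  T_involution : ∀ t ∈ T, orderOf t = 2
  T_stable : ∀ (g : G), ∀ t ∈ T, g * t * g⁻¹ ∈ T
  T_generates : Subgroup.closure T = ⊤
  /-- the inner product -/
  B : LinearMap.BilinForm ℝ V
  inner_B : IsInnerProduct B
  m1 : ∀ u v w : V, B u (v * w) = B (u * v) w
  m2 : ∀ u v : V, B (u * v) (u * v) ≤ B (u * u) (v * v)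
  /-- the linear representation of `G` -/
  φ : G →* (V ≃ₗ[ℝ] V)
  φ_mul : ∀ (g : G) (u v : V), φ g (u * v) = φ g u * φ g v
  φ_form : ∀ (g : G) (u v : V), B (φ g u) (φ g v) = B u v
  /-- the parametrisation of the Majorana axes by `T` -/
  ψ : T → V
  ψ_injective : Function.Injective ψ
  ψ_axis : ∀ t : T, IsMajoranaAxis B (ψ t)
  generated : NonUnitalAlgebra.adjoin ℝ (Set.range ψ) = ⊤
  ψ_conj : ∀ (g : G) (t : T), ψ ⟨g * t * g⁻¹, T_stable g t t.2⟩ = φ g (ψ t)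
  /-- `t` acts on `V` as the Majorana involution `τ(ψ(t))`. -/
  φ_tau : ∀ t : T, IsTau (ψ t) (φ (t : G)).toLinearMap
  m8_mem : ∀ (t₀ t₁ : T) (r : V), IsType2A B (ψ t₀) (ψ t₁) r →
    ∃ h : (t₀ : G) * (t₁ : G) ∈ T, ψ ⟨(t₀ : G) * (t₁ : G), h⟩ = r
  m8_type : ∀ t₀ t₁ t₂ : T, (t₀ : G) * (t₁ : G) * (t₂ : G) = 1 →
    IsType2A B (ψ t₀) (ψ t₁) (ψ t₂)

open Equiv in
/-- `K = ⟨(1,2), (1,3)(2,4), (5,6)⟩`. The six points are the elements `1, 2, 3, 4, 5, 6 = 0`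
of `Fin 6` (numerals are read modulo 6). -/
def K : Subgroup (Perm (Fin 6)) :=
  Subgroup.closure {swap 1 2, swap 1 3 * swap 2 4, swap 5 6}

open Equiv in
/-- The involutions `t_1, …, t_11` in this order, so that `t_i` is `invol (i - 1)`. -/
def invol : Fin 11 → Perm (Fin 6) :=
  ![swap 1 2,
    swap 3 4,
    swap 1 2 * swap 5 6,
    swap 3 4 * swap 5 6,
    swap 1 3 * swap 2 4 * swap 5 6,
    swap 1 4 * swap 2 3 * swap 5 6,
    swap 1 3 * swap 2 4,
    swap 1 4 * swap 2 3,
    swap 1 2 * swap 3 4,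
    swap 1 2 * swap 3 4 * swap 5 6,
    swap 5 6]

/-- `S = {t_1, …, t_10}`, as a subset of `K`. -/
def S : Set K := {x | ∃ i : Fin 11, (i : ℕ) < 10 ∧ (x : Equiv.Perm (Fin 6)) = invol i}

end Majorana

/-! Write a_i for the axis of t_i. The contradiction comes from the absence of t₁₁ = (5,6) from S.
Since t₁ and t₃ commute, each Majorana involution fixes the other axis, and the fusion rules then
leave only the types 2A and 2B (`type2B_or_type2A`). Type 2A would put t₁t₃ = t₁₁ in S by (M8), so
a₁ · a₃ = 0 and (a₁, a₃) = 0. On the other hand t₇ interchanges t₃ and t₄, so a₇ · (a₄ - a₃) = (a₄ -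
a₃)/2⁵. Pair this with a₁. By associativity of the form the left side is (a₁ · a₄, a₇) = (a₁ + a₄ -
a₁₀, a₇)/8, because t₁t₄ = t₁₀. Here (a₁₀, a₇) = 1/8, while (a₁, a₇) = (a₄, a₇) = 1/2⁶ by
`form_eq_of_type4B`. So the left side is -3/2⁸, but the right side is (a₁, a₄)/2⁵ = 1/2⁸. -/

namespace Majorana

open Equiv

/-! ### The group K and its involutions, by finite computation. -/

section Group

/-- The embedding of `2 × D₈` in the symmetric group with image `K`, as a function. -/
def toPerm : Multiplicative (ZMod 2) × DihedralGroup 4 → Perm (Fin 6)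
  | (z, .r i) => swap 5 6 ^ (z.toAdd.val) * (swap 1 2 * (swap 1 3 * swap 2 4)) ^ i.val
  | (z, .sr i) =>
    swap 5 6 ^ (z.toAdd.val) * (swap 1 2 * (swap 1 2 * (swap 1 3 * swap 2 4)) ^ i.val)

set_option maxRecDepth 100000 in
theorem toPerm_mul : ∀ x y, toPerm (x * y) = toPerm x * toPerm y := by decide +kernel

set_option maxRecDepth 100000 in
theorem toPerm_injective : Function.Injective toPerm := by
  unfold Function.Injective
  decide +kernel

/-- The embedding of `2 × D₈` in the symmetric group with image `K`. -/
def permHom : Multiplicative (ZMod 2) × DihedralGroup 4 →* Perm (Fin 6) :=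
  MonoidHom.mk' toPerm toPerm_mul

theorem swap_mem_K : (swap 1 2 : Perm (Fin 6)) ∈ K := Subgroup.subset_closure (by simp)

theorem swap_mul_swap_mem_K : (swap 1 3 * swap 2 4 : Perm (Fin 6)) ∈ K :=
  Subgroup.subset_closure (by simp)

theorem swap_five_six_mem_K : (swap 5 6 : Perm (Fin 6)) ∈ K :=
  Subgroup.subset_closure (by simp)

theorem range_permHom : permHom.range = K := by
  apply le_antisymm
  · rintro _ ⟨⟨z, d⟩, rfl⟩
    change toPerm (z, d) ∈ K
    have hr := K.mul_mem swap_mem_K swap_mul_swap_mem_K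
    cases d with
    | r i => exact K.mul_mem (K.pow_mem swap_five_six_mem_K _) (K.pow_mem hr _)
    | sr i =>
      exact K.mul_mem (K.pow_mem swap_five_six_mem_K _) (K.mul_mem swap_mem_K (K.pow_mem hr _))
  · rw [K, Subgroup.closure_le]
    rintro x (rfl | rfl | rfl)
    · exact ⟨(1, .sr 0), by change toPerm (1, .sr 0) = _; decide +kernel⟩
    · exact ⟨(1, .sr 1), by change toPerm (1, .sr 1) = _; decide +kernel⟩
    · exact ⟨(Multiplicative.ofAdd 1, .r 0), by change toPerm (Multiplicative.ofAdd 1, .r 0) = _; decide +kernel⟩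

theorem nonempty_mulEquiv : Nonempty (K ≃* Multiplicative (ZMod 2) × DihedralGroup 4) :=
  ⟨((MonoidHom.ofInjective (f := permHom) toPerm_injective).trans
    (MulEquiv.subgroupCongr range_permHom)).symm⟩

theorem invol_injective : Function.Injective invol := by
  unfold Function.Injective
  decide +kernel

theorem toPerm_involution : ∀ x, toPerm x ^ 2 = 1 → toPerm x ≠ 1 → ∃ i, invol i = toPerm x := by
  decide +kernel

theorem exists_toPerm_eq_invol : ∀ i, ∃ x, toPerm x = invol i := by decide +kernel

theorem invol_sq : ∀ i, invol i ^ 2 = 1 ∧ invol i ≠ 1 := by decide +kernel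

theorem invol_mem_K (i : Fin 11) : invol i ∈ K := by
  rw [← range_permHom]
  exact exists_toPerm_eq_invol i

theorem involutions_eq : {x : Perm (Fin 6) | x ∈ K ∧ orderOf x = 2} = Set.range invol := by
  ext x
  simp only [Set.mem_ofPred_eq, orderOf_eq_prime_iff]
  constructor
  · rintro ⟨hx, h2, h1⟩
    rw [← range_permHom] at hx
    obtain ⟨y, rfl⟩ := hx
    exact toPerm_involution y h2 h1
  · rintro ⟨i, rfl⟩
    exact ⟨invol_mem_K i, invol_sq i⟩

end Group

/-! ### Fusion rules and pairs of Majorana axes. -/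

section Algebra

set_option linter.unusedSectionVars false

variable {V : Type*} [NonUnitalNonAssocCommRing V] [Module ℝ V]
  [IsScalarTower ℝ V V] [SMulCommClass ℝ V V] {B : LinearMap.BilinForm ℝ V}

theorem mem_eigSpace {a v : V} {μ : ℝ} : v ∈ eigSpace a μ ↔ a * v = μ • v := by
  simp [eigSpace]

namespace IsMajoranaAxis

variable {a b : V}

theorem exists_decomposition (ha : IsMajoranaAxis B a) (v : V) :
    ∃ v₁ ∈ eigSpace a 1, ∃ v₀ ∈ eigSpace a 0, ∃ v₄ ∈ eigSpace a (1 / 2 ^ 2),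
      ∃ v₃₂ ∈ eigSpace a (1 / 2 ^ 5), v = v₁ + v₀ + v₄ + v₃₂ := by
  have h : v ∈ ⨆ i, eigSpace a (eigVal i) := by
    rw [ha.m4.submodule_iSup_eq_top]; trivial
  rw [Submodule.mem_iSup_iff_exists_finsupp] at h
  obtain ⟨f, hf, hv⟩ := h
  refine ⟨f 0, hf 0, f 1, hf 1, f 2, hf 2, f 3, hf 3, ?_⟩
  rw [← hv, Finsupp.sum_fintype _ _ (fun _ => rfl), Fin.sum_univ_four]

/-- The components of v outside the 1/2⁵-eigenspace are fixed by τ, so their sum equals its own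
negative. -/
theorem mem_eigSpace_of_tau_eq_neg (ha : IsMajoranaAxis B a) {τ : V →ₗ[ℝ] V} (hτ : IsTau a τ)
    {v : V} (hv : τ v = -v) : v ∈ eigSpace a (1 / 2 ^ 5) := by
  obtain ⟨v₁, h₁, v₀, h₀, v₄, h₄, v₃₂, h₃₂, rfl⟩ := ha.exists_decomposition v
  rw [map_add, map_add, map_add, hτ.one _ h₁, hτ.zero _ h₀, hτ.quarter _ h₄, hτ.inv32 _ h₃₂] at hv
  have h : v₁ + v₀ + v₄ = 0 := by
    have : (2 : ℝ) • (v₁ + v₀ + v₄) = 0 := by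
      linear_combination (norm := module) hv
    exact (smul_eq_zero.mp this).resolve_left two_ne_zero
  rw [h, zero_add]
  exact h₃₂

theorem exists_decomposition_of_tau_eq (ha : IsMajoranaAxis B a) {τ : V →ₗ[ℝ] V}
    (hτ : IsTau a τ) {v : V} (hv : τ v = v) :
    ∃ v₁ ∈ eigSpace a 1, ∃ v₀ ∈ eigSpace a 0, ∃ v₄ ∈ eigSpace a (1 / 2 ^ 2),
      v = v₁ + v₀ + v₄ := by
  obtain ⟨v₁, h₁, v₀, h₀, v₄, h₄, v₃₂, h₃₂, rfl⟩ := ha.exists_decomposition v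
  rw [map_add, map_add, map_add, hτ.one _ h₁, hτ.zero _ h₀, hτ.quarter _ h₄, hτ.inv32 _ h₃₂] at hv
  have h : v₃₂ = 0 := by
    have : (2 : ℝ) • v₃₂ = 0 := by
      linear_combination (norm := module) -hv
    exact (smul_eq_zero.mp this).resolve_left two_ne_zero
  exact ⟨v₁, h₁, v₀, h₀, v₄, h₄, by rw [h, add_zero]⟩

theorem coe_sigma_apply {σ : plusPart a →ₗ[ℝ] plusPart a} (hσ : IsSigma a σ) {v₁ v₀ v₄ : V}
    (h₁ : v₁ ∈ eigSpace a 1) (h₀ : v₀ ∈ eigSpace a 0) (h₄ : v₄ ∈ eigSpace a (1 / 2 ^ 2))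
    (h : v₁ + v₀ + v₄ ∈ plusPart a) : (σ ⟨v₁ + v₀ + v₄, h⟩ : V) = v₁ + v₀ - v₄ := by
  have m₁ : v₁ ∈ plusPart a := Submodule.mem_sup_left (Submodule.mem_sup_left h₁)
  have m₀ : v₀ ∈ plusPart a := Submodule.mem_sup_left (Submodule.mem_sup_right h₀)
  have m₄ : v₄ ∈ plusPart a := Submodule.mem_sup_right h₄
  have e : (⟨v₁ + v₀ + v₄, h⟩ : plusPart a) = ⟨v₁, m₁⟩ + ⟨v₀, m₀⟩ + ⟨v₄, m₄⟩ := rfl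
  rw [e, map_add, map_add, hσ.one _ h₁, hσ.zero _ h₀, hσ.quarter _ h₄]
  simp [sub_eq_add_neg]

theorem exists_of_mem_plusPart {v : V} (hv : v ∈ plusPart a) :
    ∃ v₁ ∈ eigSpace a 1, ∃ v₀ ∈ eigSpace a 0, ∃ v₄ ∈ eigSpace a (1 / 2 ^ 2),
      v = v₁ + v₀ + v₄ := by
  obtain ⟨w, hw, v₄, h₄, rfl⟩ := Submodule.mem_sup.mp hv
  obtain ⟨v₁, h₁, v₀, h₀, rfl⟩ := Submodule.mem_sup.mp hw
  exact ⟨v₁, h₁, v₀, h₀, v₄, h₄, rfl⟩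

/-- A fusion rule: σ(a) preserves products on the plus part, so it negates u * v, which kills the
components for 1 and 0. -/
theorem zero_mul_quarter (ha : IsMajoranaAxis B a) {u v : V} (hu : u ∈ eigSpace a 0)
    (hv : v ∈ eigSpace a (1 / 2 ^ 2)) : u * v ∈ eigSpace a (1 / 2 ^ 2) := by
  obtain ⟨σ, hσ, hm⟩ := ha.m7
  have mu : u ∈ plusPart a := Submodule.mem_sup_left (Submodule.mem_sup_right hu)
  have mv : v ∈ plusPart a := Submodule.mem_sup_right hv
  obtain ⟨h, he⟩ := hm ⟨u, mu⟩ ⟨v, mv⟩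
  rw [hσ.zero ⟨u, mu⟩ hu, hσ.quarter ⟨v, mv⟩ hv] at he
  obtain ⟨w₁, h₁, w₀, h₀, w₄, h₄, hw⟩ := exists_of_mem_plusPart h
  simp only [hw, Submodule.coe_neg, mul_neg] at he
  rw [coe_sigma_apply hσ h₁ h₀ h₄] at he
  have h0 : w₁ + w₀ = 0 := by
    have : (2 : ℝ) • (w₁ + w₀) = 0 := by
      linear_combination (norm := module) -he
    exact (smul_eq_zero.mp this).resolve_left two_ne_zero
  rw [hw, h0, zero_add]
  exact h₄

/-- A fusion rule: the two signs cancel, so σ(a) fixes u * v and its 1/4-component vanishes; (M5)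
makes the 1-component a multiple of a. -/
theorem quarter_mul_quarter (ha : IsMajoranaAxis B a) {u v : V} (hu : u ∈ eigSpace a (1 / 2 ^ 2))
    (hv : v ∈ eigSpace a (1 / 2 ^ 2)) :
    ∃ c : ℝ, ∃ w ∈ eigSpace a 0, u * v = c • a + w := by
  obtain ⟨σ, hσ, hm⟩ := ha.m7
  have mu : u ∈ plusPart a := Submodule.mem_sup_right hu
  have mv : v ∈ plusPart a := Submodule.mem_sup_right hv
  obtain ⟨h, he⟩ := hm ⟨u, mu⟩ ⟨v, mv⟩
  rw [hσ.quarter ⟨u, mu⟩ hu, hσ.quarter ⟨v, mv⟩ hv] at he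
  obtain ⟨w₁, h₁, w₀, h₀, w₄, h₄, hw⟩ := exists_of_mem_plusPart h
  simp only [hw, Submodule.coe_neg, mul_neg, neg_mul, neg_neg] at he
  rw [coe_sigma_apply hσ h₁ h₀ h₄] at he
  have h0 : w₄ = 0 := by
    have : (2 : ℝ) • w₄ = 0 := by
      linear_combination (norm := module) he
    exact (smul_eq_zero.mp this).resolve_left two_ne_zero
  rw [ha.m5] at h₁
  obtain ⟨c, rfl⟩ := Submodule.mem_span_singleton.mp h₁
  exact ⟨c, w₀, h₀, by rw [hw, h0, add_zero]⟩

/-- For axes `a` and `b` with `τ(a)` fixing `b`, the product `a(ab)`. -/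
theorem mul_mul_of_tau_eq (ha : IsMajoranaAxis B a)
    (hB : ∀ u v w : V, B u (v * w) = B (u * v) w)
    {τ : V →ₗ[ℝ] V} (hτ : IsTau a τ) (hb : τ b = b) :
    a * (a * b) = (1 / 4 : ℝ) • (a * b) + (3 / 4 * B a b) • a := by
  obtain ⟨v₁, h₁, v₀, h₀, v₄, h₄, hv⟩ := ha.exists_decomposition_of_tau_eq hτ hb
  rw [ha.m5] at h₁
  obtain ⟨c, rfl⟩ := Submodule.mem_span_singleton.mp h₁
  rw [mem_eigSpace] at h₀ h₄
  -- Eigenvectors for different eigenvalues are orthogonal, so the coefficient of a in b is (a, b).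
  have b₀ : B a v₀ = 0 := by
    have := hB a a v₀
    rwa [h₀, zero_smul, map_zero, ha.m3_idem, eq_comm] at this
  have b₄ : B a v₄ = 0 := by
    have := hB a a v₄
    rw [h₄, ha.m3_idem, map_smul, smul_eq_mul] at this
    linarith
  have hc : B a b = c := by simp [hv, b₀, b₄, ha.m3_length]
  rw [hc, hv]
  simp only [mul_add, mul_smul_comm, ha.m3_idem, h₀, h₄]
  module

/-- For axes `a` and `b` with `τ(a)` fixing `b`, the square of `ab`. -/
theorem mul_mul_mul_of_tau_eq (ha : IsMajoranaAxis B a)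
    (hB : ∀ u v w : V, B u (v * w) = B (u * v) w)
    {τ : V →ₗ[ℝ] V} (hτ : IsTau a τ) (hτb : τ b = b)
    (hbb : b * (a * b) = (1 / 4 : ℝ) • (a * b) + (3 / 4 * B a b) • b) :
    (a * b) * (a * b) = (1 / 16 : ℝ) •
      ((B a b + 16 * B a b ^ 2) • a + (3 * B a b) • b - (4 * B a b) • (a * b)) := by
  have haa := ha.mul_mul_of_tau_eq hB hτ hτb
  generalize B a b = r at *
  set u := a * b with hu
  have hua : u * a = (1 / 4 : ℝ) • u + (3 / 4 * r) • a := by rw [mul_comm, haa]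
  have hub : u * b = (1 / 4 : ℝ) • u + (3 / 4 * r) • b := by rw [mul_comm, hbb]
  -- If b = r a + v₀ + v₄ is the eigenvector decomposition, this vector is v₀ and the next one, u -
  -- r a, is v₄/4.
  have m₀ : b + (3 * r) • a - (4 : ℝ) • u ∈ eigSpace a 0 := by
    rw [mem_eigSpace]
    simp only [mul_add, mul_sub, mul_smul_comm, ha.m3_idem, ← hu, haa]
    module
  have m₄ : u - r • a ∈ eigSpace a (1 / 2 ^ 2) := by
    rw [mem_eigSpace]
    simp only [mul_sub, mul_smul_comm, ha.m3_idem, haa]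
    module
  have f₄ := mem_eigSpace.mp (ha.zero_mul_quarter m₀ m₄)
  obtain ⟨c, w, hw, f₀⟩ := ha.quarter_mul_quarter m₄ m₄
  rw [mem_eigSpace] at hw
  have ba : b * a = u := mul_comm b a
  have hx : (b + (3 * r) • a - (4 : ℝ) • u) * (u - r • a) =
      (1 / 4 + 3 / 4 * r : ℝ) • u + (3 / 4 * r) • b + (9 / 4 * r ^ 2) • a - (4 : ℝ) • (u * u) := by
    simp only [add_mul, sub_mul, mul_sub, smul_mul_assoc, mul_smul_comm, ha.m3_idem, haa, hbb,
      hua, ba]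
    module
  have hy : (u - r • a) * (u - r • a) = u * u - (r / 2) • u - (r ^ 2 / 2) • a := by
    simp only [sub_mul, mul_sub, smul_mul_assoc, mul_smul_comm, ha.m3_idem, haa, hua]
    module
  rw [hx] at f₄
  rw [hy] at f₀
  -- Both fusion rules involve u * u. Eliminating it expresses w through a, b and u, and then a * w
  -- = 0 determines c.
  have huu : u * u = (r / 2) • u + (r ^ 2 / 2 + c) • a + w := by
    linear_combination (norm := module) f₀
  rw [huu] at f₄
  simp only [mul_add, mul_sub, mul_smul_comm, ha.m3_idem, haa, hw, ← hu] at f₄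
  have ew : w = (-(3 / 16) * r * (1 - 5 * r) - 3 / 16 * r ^ 2 + 3 * c) • a - (3 / 4 * r) • u +
      (3 / 16 * r) • b := by
    linear_combination (norm := module) f₄
  have hc : (3 * (c - (r - r ^ 2) / 16)) • a = 0 := by
    rw [ew] at hw
    simp only [mul_add, mul_sub, mul_smul_comm, ha.m3_idem, haa, ← hu] at hw
    linear_combination (norm := module) hw
  have hc' : c = (r - r ^ 2) / 16 := by
    have := (smul_eq_zero.mp hc).resolve_right ha.ne_zero
    linarith
  rw [huu, ew, hc']
  module

/-- Two distinct axes, each fixed by the Majorana involution of the other, are orthogonal with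
product zero (type `2B`) or generate an algebra of type `2A`. -/
theorem type2B_or_type2A (ha : IsMajoranaAxis B a) (hb : IsMajoranaAxis B b)
    (hI : IsInnerProduct B) (hB : ∀ u v w : V, B u (v * w) = B (u * v) w) (hab : a ≠ b)
    {τ τ' : V →ₗ[ℝ] V} (hτ : IsTau a τ) (hτb : τ b = b) (hτ' : IsTau b τ') (hτa : τ' a = a) :
    (B a b = 0 ∧ a * b = 0) ∨ IsType2A B a b (a + b - (8 : ℝ) • (a * b)) := by
  have haa := ha.mul_mul_of_tau_eq hB hτ hτb
  have hbb := hb.mul_mul_of_tau_eq hB hτ' hτa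
  rw [mul_comm b a, hI.symm b a] at hbb
  have h₁ := ha.mul_mul_mul_of_tau_eq hB hτ hτb hbb
  have h₂ := hb.mul_mul_mul_of_tau_eq hB hτ' hτa (by rw [mul_comm b a, hI.symm b a, haa])
  rw [mul_comm b a, hI.symm b a] at h₂
  have hr : B a b = 0 ∨ B a b = 1 / 8 := by
    -- The formula for the square of ab is not visibly symmetric in a and b; subtracting its two
    -- versions leaves this multiple of a - b.
    have h : (B a b * (B a b - 1 / 8)) • (a - b) = 0 := by
      linear_combination (norm := module) h₂ - h₁
    rcases mul_eq_zero.mp ((smul_eq_zero.mp h).resolve_right (sub_ne_zero.mpr hab)) with h | h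
    · exact .inl h
    · exact .inr (sub_eq_zero.mp h)
  have fau : B a (a * b) = B a b := by rw [hB, ha.m3_idem]
  have fbu : B b (a * b) = B a b := by rw [mul_comm a b, hB, hb.m3_idem, hI.symm]
  have fuu : B (a * b) (a * b) = B a b / 4 + 3 / 4 * B a b ^ 2 := by
    rw [hB, mul_comm (a * b) a, haa]
    simp only [map_add, map_smul, LinearMap.add_apply, LinearMap.smul_apply, smul_eq_mul]
    rw [hI.symm (a * b) b, fbu]
    ring
  rcases hr with hr | hr
  · left
    -- The squared length of ab is r/4 + 3r²/4 with r = (a, b), so ab vanishes with r.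
    refine ⟨hr, ?_⟩
    by_contra h
    have := hI.pos _ h
    rw [fuu, hr] at this
    norm_num at this
  · right
    rw [hr] at fau fbu fuu haa hbb h₁
    have fba : B b a = 1 / 8 := by rw [hI.symm, hr]
    have fua : B (a * b) a = 1 / 8 := by rw [hI.symm, fau]
    have fub : B (a * b) b = 1 / 8 := by rw [hI.symm, fbu]
    have hua : a * b * a = (1 / 4 : ℝ) • (a * b) + (3 / 4 * (1 / 8) : ℝ) • a := by
      rw [mul_comm, haa]
    have hub : a * b * b = (1 / 4 : ℝ) • (a * b) + (3 / 4 * (1 / 8) : ℝ) • b := by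
      rw [mul_comm, hbb]
    have ba : b * a = a * b := mul_comm b a
    obtain ⟨r, hrdef⟩ : ∃ r, r = a + b - (8 : ℝ) • (a * b) := ⟨_, rfl⟩
    rw [← hrdef]
    have idem_r : r * r = r := by
      rw [hrdef]
      simp only [mul_add, mul_sub, add_mul, sub_mul, smul_mul_assoc, mul_smul_comm, ha.m3_idem,
        hb.m3_idem, haa, hbb, hua, hub, ba, h₁]
      module
    have mul₀₁ : a * b = (1 / 2 ^ 3 : ℝ) • (a + b - r) := by rw [hrdef]; module
    have mul₀r : a * r = (1 / 2 ^ 3 : ℝ) • (a + r - b) := by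
      rw [hrdef]
      simp only [mul_add, mul_sub, mul_smul_comm, ha.m3_idem, haa]
      module
    have mul₁r : b * r = (1 / 2 ^ 3 : ℝ) • (b + r - a) := by
      rw [hrdef]
      simp only [mul_add, mul_sub, mul_smul_comm, hb.m3_idem, hbb, ba]
      module
    have form₀r : B a r = 1 / 2 ^ 3 := by
      simp only [hrdef, map_add, map_sub, map_smul, smul_eq_mul, ha.m3_length, hr, fau]
      norm_num
    have form₁r : B b r = 1 / 2 ^ 3 := by
      simp only [hrdef, map_add, map_sub, map_smul, smul_eq_mul, hb.m3_length, fba, fbu]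
      norm_num
    have len_r : B r r = 1 := by
      nth_rw 1 [hrdef]
      simp only [map_add, map_sub, map_smul, smul_eq_mul, LinearMap.add_apply,
        LinearMap.sub_apply, LinearMap.smul_apply, form₀r, form₁r]
      simp only [hrdef, map_add, map_sub, map_smul, smul_eq_mul, fua, fub, fuu]
      norm_num
    have fr₀ : B r a = 1 / 2 ^ 3 := by rw [hI.symm, form₀r]
    have fr₁ : B r b = 1 / 2 ^ 3 := by rw [hI.symm, form₁r]
    have rmem : r ∈ NonUnitalAlgebra.adjoin ℝ ({a, b} : Set V) := by
      have m₀ : a ∈ NonUnitalAlgebra.adjoin ℝ ({a, b} : Set V) :=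
        NonUnitalAlgebra.subset_adjoin ℝ (by simp)
      have m₁ : b ∈ NonUnitalAlgebra.adjoin ℝ ({a, b} : Set V) :=
        NonUnitalAlgebra.subset_adjoin ℝ (by simp)
      rw [hrdef]
      exact sub_mem (add_mem m₀ m₁) (SMulMemClass.smul_mem _ (mul_mem m₀ m₁))
    refine ⟨?_, ?_, ha.m3_idem, hb.m3_idem, idem_r, mul₀₁, mul₀r, mul₁r, ha.m3_length,
      hb.m3_length, len_r, by rw [hr]; norm_num, form₀r, form₁r⟩
    · rw [Fintype.linearIndependent_iff]
      intro g hg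
      simp only [Fin.sum_univ_three, Matrix.cons_val] at hg
      -- The Gram matrix, with 1 on the diagonal and 1/8 elsewhere, is invertible.
      have e₀ := congrArg (B a) hg
      have e₁ := congrArg (B b) hg
      have e₂ := congrArg (B r) hg
      simp only [map_add, map_smul, smul_eq_mul, map_zero, ha.m3_length, hb.m3_length, len_r, hr,
        fba, form₀r, form₁r, fr₀, fr₁] at e₀ e₁ e₂
      intro i
      fin_cases i
      · change g 0 = 0; linarith
      · change g 1 = 0; linarith
      · change g 2 = 0; linarith
    · apply le_antisymm
      · rw [Submodule.span_le]
        rintro x (rfl | rfl | rfl)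
        · exact NonUnitalAlgebra.subset_adjoin ℝ (by simp)
        · exact NonUnitalAlgebra.subset_adjoin ℝ (by simp)
        · exact rmem
      · intro x hx
        change x ∈ NonUnitalAlgebra.adjoin ℝ ({a, b} : Set V) at hx
        induction hx using NonUnitalAlgebra.adjoin_induction with
        | mem x hx => exact Submodule.subset_span (by rcases hx with rfl | rfl <;> simp)
        | add x y _ _ hx hy => exact add_mem hx hy
        | zero => exact zero_mem _
        | smul c x _ hx => exact Submodule.smul_mem _ c hx
        | mul x y _ _ hx hy =>
          obtain ⟨p, q, s, rfl⟩ := Submodule.mem_span_triple.mp hx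
          obtain ⟨p', q', s', rfl⟩ := Submodule.mem_span_triple.mp hy
          have ra : r * a = (1 / 2 ^ 3 : ℝ) • (a + r - b) := by rw [mul_comm, mul₀r]
          have rb : r * b = (1 / 2 ^ 3 : ℝ) • (b + r - a) := by rw [mul_comm, mul₁r]
          have m₀ : a ∈ Submodule.span ℝ {a, b, r} := Submodule.subset_span (by simp)
          have m₁ : b ∈ Submodule.span ℝ {a, b, r} := Submodule.subset_span (by simp)
          have m₂ : r ∈ Submodule.span ℝ {a, b, r} := Submodule.subset_span (by simp)
          simp only [mul_add, add_mul, smul_mul_assoc, mul_smul_comm, ha.m3_idem, hb.m3_idem,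
            idem_r, ba, mul₀₁, mul₀r, mul₁r, ra, rb]
          repeat first
            | assumption
            | apply add_mem
            | apply sub_mem
            | apply Submodule.smul_mem

end IsMajoranaAxis

/-- Four axes in two pairs, all of whose cross inner products agree: this common value is
`1 / 2 ^ 6` if both pairs generate algebras of type `2A` with the same third axis and the
difference of each pair is a `1 / 2 ^ 5`-eigenvector of the axes in the other. -/
theorem form_eq_of_type4B (hI : IsInnerProduct B) (hB : ∀ u v w : V, B u (v * w) = B (u * v) w)
    {a₀ a₁ b₀ b₁ c : V} (ha : IsType2A B a₀ a₁ c) (hb : IsType2A B b₀ b₁ c)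
    (hbd : b₀ * (a₀ - a₁) = (1 / 2 ^ 5 : ℝ) • (a₀ - a₁))
    (hbd' : b₁ * (a₀ - a₁) = (1 / 2 ^ 5 : ℝ) • (a₀ - a₁)) {p : ℝ}
    (h₀₀ : B a₀ b₀ = p) (h₀₁ : B a₀ b₁ = p) (h₁₀ : B a₁ b₀ = p) (h₁₁ : B a₁ b₁ = p) :
    p = 1 / 2 ^ 6 := by
  -- Pairing this with a₀ gives the linear equation 3p/2 + 1/2⁵ = 7/2⁷.
  have e₁ : a₀ * (b₀ + b₁) - a₁ * (b₀ + b₁) = (1 / 2 ^ 4 : ℝ) • (a₀ - a₁) := by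
    rw [← sub_mul, mul_comm, add_mul, hbd, hbd']
    module
  have e₂ := congrArg (B a₀) e₁
  rw [map_sub, hB, hB, ha.idem₀, ha.mul₀₁] at e₂
  have c₀ : B c b₀ = 1 / 2 ^ 3 := by rw [hI.symm, hb.form₀r]
  have c₁ : B c b₁ = 1 / 2 ^ 3 := by rw [hI.symm, hb.form₁r]
  simp only [map_add, map_sub, map_smul, smul_eq_mul, LinearMap.add_apply,
    LinearMap.sub_apply, LinearMap.smul_apply, h₀₀, h₀₁, h₁₀, h₁₁, ha.len₀, ha.form₀₁, c₀, c₁] at e₂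
  linarith

end Algebra
-- The contradiction in a representation of (K, S).
section Representation

variable {U : Type*} [NonUnitalNonAssocCommRing U] [Module ℝ U]
  [IsScalarTower ℝ U U] [SMulCommClass ℝ U U]

/-- The elements of `S`, indexed from zero. -/
def involS (i : Fin 10) : S := ⟨⟨invol i.castSucc, invol_mem_K _⟩, i.castSucc, i.2, rfl⟩

namespace MajoranaRepresentation

variable (R : MajoranaRepresentation K S U)

theorem φ_axis {i j k : Fin 10}
    (h : invol i.castSucc * invol j.castSucc * (invol i.castSucc)⁻¹ = invol k.castSucc) :
    R.φ (involS i : K) (R.ψ (involS j)) = R.ψ (involS k) := by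
  rw [← R.ψ_conj]
  exact congrArg R.ψ (Subtype.ext (Subtype.ext h))

theorem isType2A_axis {i j k : Fin 10}
    (h : invol i.castSucc * invol j.castSucc * invol k.castSucc = 1) :
    IsType2A R.B (R.ψ (involS i)) (R.ψ (involS j)) (R.ψ (involS k)) :=
  R.m8_type _ _ _ (Subtype.ext h)

/-- Conjugation by the involution t_i interchanges t_j and t_k, so τ(ψ(t_i)) negates the difference
of their axes. -/
theorem axis_mul_sub {i j k : Fin 10}
    (h : invol i.castSucc * invol j.castSucc * (invol i.castSucc)⁻¹ = invol k.castSucc) :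
    R.ψ (involS i) * (R.ψ (involS j) - R.ψ (involS k)) =
      (1 / 2 ^ 5 : ℝ) • (R.ψ (involS j) - R.ψ (involS k)) := by
  have h' : invol i.castSucc * invol k.castSucc * (invol i.castSucc)⁻¹ = invol j.castSucc := by
    have hs : invol i.castSucc * invol i.castSucc = 1 := by
      rw [← sq]; exact (invol_sq _).1
    rw [← h, inv_eq_of_mul_eq_one_left hs]
    rw [mul_assoc, mul_assoc, mul_assoc, hs, mul_one, ← mul_assoc, hs, one_mul]
  rw [← mem_eigSpace]
  apply (R.ψ_axis _).mem_eigSpace_of_tau_eq_neg (R.φ_tau _)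
  change R.φ (involS i : K) _ = _
  rw [map_sub, R.φ_axis h, R.φ_axis h', neg_sub]

theorem form_axis {g i j i' j' : Fin 10}
    (h : invol g.castSucc * invol i.castSucc * (invol g.castSucc)⁻¹ = invol i'.castSucc)
    (h' : invol g.castSucc * invol j.castSucc * (invol g.castSucc)⁻¹ = invol j'.castSucc) :
    R.B (R.ψ (involS i')) (R.ψ (involS j')) = R.B (R.ψ (involS i)) (R.ψ (involS j)) := by
  rw [← R.φ_axis h, ← R.φ_axis h', R.φ_form]

/-- The axes of `t₁` and `t₃`, whose product is not in `S`, are of type `2B`. -/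
theorem form_mul_eq_zero : R.B (R.ψ (involS 0)) (R.ψ (involS 2)) = 0 ∧
    R.ψ (involS 0) * R.ψ (involS 2) = 0 := by
  have hne : R.ψ (involS 0) ≠ R.ψ (involS 2) := fun h =>
    absurd (congrArg (fun x : S => (x.1 : Perm (Fin 6))) (R.ψ_injective h))
      (by change invol 0 ≠ invol 2; decide +kernel)
  refine ((R.ψ_axis _).type2B_or_type2A (R.ψ_axis _) R.inner_B R.m1 hne (R.φ_tau _)
    (R.φ_axis (by decide +kernel)) (R.φ_tau _) (R.φ_axis (by decide +kernel))).resolve_right ?_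
  intro h
  obtain ⟨⟨i, hi, h⟩, -⟩ := R.m8_mem _ _ _ h
  change invol 0 * invol 2 = invol i at h
  revert i
  decide +kernel

theorem isEmpty : IsEmpty (MajoranaRepresentation K S U) := by
  refine ⟨fun R => ?_⟩
  have hI := R.inner_B
  have t₁₂ : IsType2A R.B (R.ψ (involS 0)) (R.ψ (involS 1)) (R.ψ (involS 8)) :=
    R.isType2A_axis (by decide +kernel)
  have t₄₃ : IsType2A R.B (R.ψ (involS 3)) (R.ψ (involS 2)) (R.ψ (involS 8)) :=
    R.isType2A_axis (by decide +kernel)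
  have t₇₈ : IsType2A R.B (R.ψ (involS 6)) (R.ψ (involS 7)) (R.ψ (involS 8)) :=
    R.isType2A_axis (by decide +kernel)
  have t₁₄ : IsType2A R.B (R.ψ (involS 0)) (R.ψ (involS 3)) (R.ψ (involS 9)) :=
    R.isType2A_axis (by decide +kernel)
  have t₇₆ : IsType2A R.B (R.ψ (involS 6)) (R.ψ (involS 5)) (R.ψ (involS 9)) :=
    R.isType2A_axis (by decide +kernel)
  -- Conjugation by t₇ interchanges t₁ with t₂ and t₃ with t₄; below, conjugation by t₁ interchanges
  -- t₇ with t₈ and fixes t₂, t₃, t₄. This makes all cross inner products equal.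
  have g₁₇ : R.B (R.ψ (involS 1)) (R.ψ (involS 6)) = R.B (R.ψ (involS 0)) (R.ψ (involS 6)) :=
    R.form_axis (g := 6) (by decide +kernel) (by decide +kernel)
  have g₄₇ : R.B (R.ψ (involS 2)) (R.ψ (involS 6)) = R.B (R.ψ (involS 3)) (R.ψ (involS 6)) :=
    R.form_axis (g := 6) (by decide +kernel) (by decide +kernel)
  have f₁₇ := form_eq_of_type4B hI R.m1 t₁₂ t₇₈ (R.axis_mul_sub (by decide +kernel))
    (R.axis_mul_sub (by decide +kernel)) rfl
    (R.form_axis (g := 0) (by decide +kernel) (by decide +kernel)) g₁₇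
    ((R.form_axis (g := 0) (by decide +kernel) (by decide +kernel)).trans g₁₇)
  have f₄₇ := form_eq_of_type4B hI R.m1 t₄₃ t₇₈ (R.axis_mul_sub (by decide +kernel))
    (R.axis_mul_sub (by decide +kernel)) rfl
    (R.form_axis (g := 0) (by decide +kernel) (by decide +kernel)) g₄₇
    ((R.form_axis (g := 0) (by decide +kernel) (by decide +kernel)).trans g₄₇)
  have f₁₀₇ : R.B (R.ψ (involS 9)) (R.ψ (involS 6)) = 1 / 2 ^ 3 := by
    rw [hI.symm, t₇₆.form₀r]
  obtain ⟨f₁₃, p₁₃⟩ := R.form_mul_eq_zero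
  have e : R.ψ (involS 6) * (R.ψ (involS 3) - R.ψ (involS 2)) =
      (1 / 2 ^ 5 : ℝ) • (R.ψ (involS 3) - R.ψ (involS 2)) :=
    R.axis_mul_sub (by decide +kernel)
  have h := congrArg (R.B (R.ψ (involS 0))) e
  rw [mul_comm, R.m1, mul_sub, p₁₃, sub_zero, t₁₄.mul₀₁] at h
  simp only [map_add, map_sub, map_smul, smul_eq_mul, LinearMap.add_apply,
    LinearMap.sub_apply, LinearMap.smul_apply, f₁₇, f₄₇, f₁₀₇, f₁₃, t₁₄.form₀₁] at h
  -- The equation now reads -3/2⁸ = 1/2⁸.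
  norm_num at h

end MajoranaRepresentation

end Representation

end Majorana

theorem mainTheorem6 :
    Nonempty (Majorana.K ≃* Multiplicative (ZMod 2) × DihedralGroup 4) ∧
    Function.Injective Majorana.invol ∧
    {x : Equiv.Perm (Fin 6) | x ∈ Majorana.K ∧ orderOf x = 2} = Set.range Majorana.invol ∧
    ∀ (U : Type*) [NonUnitalNonAssocCommRing U] [Module ℝ U]
      [IsScalarTower ℝ U U] [SMulCommClass ℝ U U],
      IsEmpty (Majorana.MajoranaRepresentation Majorana.K Majorana.S U) :=
  ⟨Majorana.nonempty_mulEquiv, Majorana.invol_injective, Majorana.involutions_eq,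
    fun _ _ _ _ _ => Majorana.MajoranaRepresentation.isEmpty⟩
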